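/- For a real number $x$ let $\|x\|$ denote the distance from $x$ to the closest integer. For a positive integer $k$, let $LRC(k)$ be the statement that for every $(u_1,\dots,u_k)\in\mathbb{Z}_{>0}^k$ there is a real number $t$ with $\|tu_i\|\ge \frac1{k+1}$ for all $i=1,\dots,k$. Let $k\ge 2$ be an integer, $p$ a prime and $l$ a positive integer. Write $\mathbb{Z}_n=\mathbb{Z}/n\mathbb{Z}$, and let $\mathbb{Z}_{p,l}$ be the set of those elements of $\mathbb{Z}_{lp}$ that are not multiples of $p$. A tuple $\mathbf v\in\mathbb{Z}_{p,l}^k$ is called $(k,p,l)$-proper if (a) there is an index $i$ such that the greatest common divisor of $l$ and all $v_j$ with $j\ne i$ is greater than $1$, or (b) there is $t\in\frac1{lp}\mathbb{Z}$ such that $\|tv_i\|\ge\frac1{k+1}$ for all $i$ (neither condition depends on the integers chosen to represent the $v_i$). Let $I(k,p,l)$ be the set of all $\mathbf v\in\mathbb{Z}_{p,l}^k$ that are not $(k,p,l)$-proper. Let $J(k,p)$ be the set of all $\mathbf v\in\mathbb{Z}_{p,1}^k$ such that, for every positive integer $l$, $\mathbf v$ is the reduction modulo $p$ of some element of $I(k,p,l)$.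 **Proposition.** Let $k\ge 3$, and let $P$ be a finite set of primes such that $J(k,p)=\emptyset$ for all $p\in P$. If $LRC(k-1)$ holds and $$\prod_{p\in P}p\ \ge\ B_k:=\left(\frac{\binom{k+1}{2}^{k-1}}{k}\right)^{k},$$ then $LRC(k)$ holds. -/

import Mathlib

namespace LonelyRunner

/-- The distance from a real number to the closest integer. -/
noncomputable def distInt (x : ℝ) : ℝ := |x - round x|

/-- The LR property of a tuple of `k` speeds: at some time `t`, all `t * u i` are at distance
at least `1 / (k + 1)` from the integers. -/
def HasLRProperty {k : ℕ} (u : Fin k → ℝ) : Prop :=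
  ∃ t : ℝ, ∀ i, 1 / ((k : ℝ) + 1) ≤ distInt (t * u i)

/-- The Lonely Runner Conjecture for `k + 1` runners: every `k`-tuple of positive integers
has the LR property. -/
def LRC (k : ℕ) : Prop :=
  ∀ u : Fin k → ℤ, (∀ i, 0 < u i) → HasLRProperty (fun i => (u i : ℝ))

/-- The residues modulo `n` that are not multiples of `p` in `ℤ/n`. The set `ℤ_{p,l}`, that is
`ℤ/lp` with the multiples of `p` removed, is `nonMultiples p (l * p)`, and `ℤ_{p,1}` is
`nonMultiples p p`. -/
def nonMultiples (p n : ℕ) : Set (ZMod n) := {x | ¬ ∃ y : ZMod n, x = (p : ZMod n) * y}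

/-- `(k,p,l)`-properness of a tuple of residues modulo `lp`. Both conditions are independent of
the choice of representatives, so the representatives in `{0, …, lp - 1}` are used; the times
in `(1/lp)ℤ` are the numbers `m / (l * p)` with `m` an integer. -/
def IsProper (k p l : ℕ) (v : Fin k → ZMod (l * p)) : Prop :=
  (∃ i, 1 < Nat.gcd l ((Finset.univ.erase i).gcd fun j => (v j).val)) ∨
  (∃ m : ℤ, ∀ i,
    1 / ((k : ℝ) + 1) ≤ distInt ((m : ℝ) / ((l : ℝ) * (p : ℝ)) * ((v i).val : ℝ)))

/-- The set `I(k,p,l)` of improper speed tuples in `ℤ_{p,l}^k`. -/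
def I (k p l : ℕ) : Set (Fin k → ZMod (l * p)) :=
  {v | (∀ i, v i ∈ nonMultiples p (l * p)) ∧ ¬ IsProper k p l v}

/-- The coordinatewise projection `(ℤ/lp)^k → (ℤ/p)^k`. -/
def proj (k p l : ℕ) (v : Fin k → ZMod (l * p)) : Fin k → ZMod p :=
  fun i => ZMod.castHom (Dvd.intro_left l rfl : p ∣ l * p) (ZMod p) (v i)

/-- `v` is eventually `(k,p)`-proper if, for some positive integer `l`, it is not the projection
of a `(k,p,l)`-improper tuple. -/
def EventuallyProper (k p : ℕ) (v : Fin k → ZMod p) : Prop :=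
  ∃ l : ℕ, 0 < l ∧ v ∉ proj k p l '' I k p l

/-- The set `J(k,p)` of the tuples in `ℤ_{p,1}^k` that are not eventually `(k,p)`-proper. -/
def J (k p : ℕ) : Set (Fin k → ZMod p) :=
  {v | (∀ i, v i ∈ nonMultiples p p) ∧ ¬ EventuallyProper k p v}

/-- The bound `B_k = (C(k+1,2)^(k-1) / k)^k`. -/
noncomputable def B (k : ℕ) : ℝ := ((((k + 1).choose 2 : ℕ) : ℝ) ^ (k - 1) / (k : ℝ)) ^ k

end LonelyRunner

namespace LonelyRunner

open MeasureTheory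

/-! After division by the gcd, let `u` be a primitive counterexample; two bounds then collide. For
every p in P, the reduction of `u` modulo each lp with l > 0 is improper, so emptiness of J(k,p)
forces p to divide some speed (`exists_dvd_of_J_eq_empty`). Hence ∏ p ≤ ∏ u_i. On the other hand, a
large sum of speeds gives the set swept by a small cube along `u` a volume above 1. Blichfeldt's
principle yields an integer vector z close to the line ℝu but not parallel to it, and then LRC(k-1)
settles `u` (`hasLRProperty_of_lt_sum`). So ∑ u_i ≤ C(k+1,2)^(k-1), and strict AM-GM gives ∏ u_i <
B_k. -/

/-! ### Distance to the nearest integer. -/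

lemma le_distInt_iff {c x : ℝ} : c ≤ distInt x ↔ ∀ n : ℤ, c ≤ |x - n| :=
  ⟨fun h n => h.trans (round_le x n), fun h => h (round x)⟩

lemma distInt_neg_le (x : ℝ) : distInt x ≤ distInt (-x) := by
  rw [le_distInt_iff]
  intro n
  refine (round_le x (-n)).trans_eq ?_
  rw [← abs_neg]; congr 1; push_cast; ring

lemma distInt_le_add_int (x : ℝ) (n : ℤ) : distInt x ≤ distInt (x + n) := by
  rw [le_distInt_iff]
  intro m
  refine (round_le x (m - n)).trans_eq ?_
  congr 1; push_cast; ring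

lemma distInt_sub_le (x δ : ℝ) : distInt x - |δ| ≤ distInt (x + δ) := by
  rw [le_distInt_iff]
  intro m
  have h1 := round_le x m
  have h2 := abs_sub_abs_le_abs_sub (x - m) (-δ)
  rw [abs_neg, show x - m - -δ = x + δ - m by ring] at h2
  unfold distInt
  linarith

/-! ### Reduction to one speed less by simultaneous approximation. -/

/-- Deleting one entry of a tuple of nonzero speeds, the conjecture for one runner less applies. -/
lemma LRC.exists_time_ne {n : ℕ} (h : LRC n) (w : Fin (n + 1) → ℤ) (j : Fin (n + 1))
    (hw : ∀ m, m ≠ j → w m ≠ 0) :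
    ∃ t : ℝ, ∀ m, m ≠ j → 1 / ((n : ℝ) + 1) ≤ distInt (t * w m) := by
  obtain ⟨t, ht⟩ := h (fun i => |w (j.succAbove i)|)
    (fun i => abs_pos.2 (hw _ (Fin.succAbove_ne j i)))
  refine ⟨t, fun m hm => ?_⟩
  obtain ⟨i, rfl⟩ := Fin.exists_succAbove_eq hm
  refine (ht i).trans ?_
  push_cast
  rcases abs_choice (w (j.succAbove i) : ℝ) with e | e <;> rw [e]
  rw [mul_neg]
  simpa using distInt_neg_le (-(t * w (j.succAbove i)))

/-- Among integer vectors `(z m, u m)` in the upper half plane that are not all parallel there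
are two whose sum is parallel to none of the vectors. -/
lemma exists_mediant_ne {ι : Type*} [Finite ι] (u z : ι → ℤ) (hu : ∀ i, 0 < u i)
    (hz : ¬ ∀ i j, z i * u j = z j * u i) :
    ∃ i j, i ≠ j ∧ ∀ m, (z i + z j) * u m - (u i + u j) * z m ≠ 0 := by
  push Not at hz
  obtain ⟨a, b, hab⟩ := hz
  have key : ∀ x y, (z x : ℝ) / u x < z y / u y ↔ z x * u y < z y * u x := fun x y => by
    rw [div_lt_div_iff₀ (by exact_mod_cast hu x) (by exact_mod_cast hu y)]
    norm_cast
  have key' : ∀ x y, (z x : ℝ) / u x ≤ z y / u y ↔ z x * u y ≤ z y * u x := fun x y => by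
    rw [div_le_div_iff₀ (by exact_mod_cast hu x) (by exact_mod_cast hu y)]
    norm_cast
  have : Nonempty ι := ⟨a⟩
  -- Take `i` of least slope z/u and `j` of the next larger slope: the mediant lies strictly between
  -- two consecutive slopes, so it equals none.
  obtain ⟨i, hi⟩ := Finite.exists_min (fun m => (z m : ℝ) / u m)
  have hne : ∃ m, (z i : ℝ) / u i < z m / u m := by
    by_contra! hcon
    have e : ∀ m, (z m : ℝ) / u m = z i / u i := fun m => le_antisymm (hcon m) (hi m)
    have := (e a).trans (e b).symm
    exact hab (le_antisymm ((key' a b).1 this.le) ((key' b a).1 this.ge))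
  obtain ⟨j, hj, hjmin⟩ := Set.exists_min_image {m | (z i : ℝ) / u i < z m / u m}
    (fun m => (z m : ℝ) / u m) (Set.toFinite _) hne
  refine ⟨i, j, fun e => (e ▸ hj : (z i : ℝ) / u i < z i / u i).false, fun m => ?_⟩
  have hij := (key i j).1 hj
  by_cases hm : (z i : ℝ) / u i < z m / u m
  · have h1 := (key i m).1 hm
    have h2 := (key' j m).1 (hjmin m hm)
    intro h
    linarith
  · have h1 := (key' m i).1 (not_lt.1 hm)
    have h2 : z m * u j < z j * u m :=
      (key m j).1 ((not_lt.1 hm).trans_lt hj)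
    intro h
    linarith

/-- A good simultaneous approximation that is not parallel to `u` reduces the lonely runner
property of `u` to the conjecture for one runner less. -/
lemma hasLRProperty_of_approx {n : ℕ} (h : LRC n) (u z : Fin (n + 1) → ℤ) (hu : ∀ i, 0 < u i)
    (hz : ¬ ∀ i j, z i * u j = z j * u i) (r : ℝ)
    (hr : ∀ i, |z i + r * u i| ≤ 2 / (((n : ℝ) + 1) * (n + 2))) :
    HasLRProperty (fun i => (u i : ℝ)) := by
  obtain ⟨i, j, hij, hw⟩ := exists_mediant_ne u z hu hz
  -- The entries at `i` and `j` are opposite, so a time that works away from `j` works at `j` too.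
  obtain ⟨t, ht⟩ := h.exists_time_ne (fun m => (z i + z j) * u m - (u i + u j) * z m) j
    (fun m _ => hw m)
  have ht' : ∀ m, 1 / ((n : ℝ) + 1) ≤
      distInt (t * ((z i + z j) * u m - (u i + u j) * z m)) := by
    intro m
    by_cases hm : m = j
    · refine (ht i hij).trans ((distInt_neg_le _).trans_eq ?_)
      subst hm
      push_cast
      congr 1; ring
    · simpa using ht m hm
  set a : ℝ := -(t * (u i + u j)) with ha
  -- Modulo 1 the coefficient `a` of `z m` may be replaced by `a - round a`, of size at most 1/2;
  -- then `z m` is traded for `-r * u m`.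
  refine ⟨t * (z i + z j) - (a - round a) * r, fun m => ?_⟩
  have h1 := (ht' m).trans (distInt_le_add_int _ (-(round a * z m)))
  have h2 := distInt_sub_le (t * ((z i + z j) * u m - (u i + u j) * z m) +
    ((-(round a * z m) : ℤ) : ℝ)) (-((a - round a) * (z m + r * u m)))
  have h3 : |-((a - round a) * (z m + r * u m))| ≤ 1 / 2 * (2 / (((n : ℝ) + 1) * (n + 2))) := by
    rw [abs_neg, abs_mul]
    exact mul_le_mul (abs_sub_round a) (hr m) (abs_nonneg _) (by norm_num)
  -- The tolerance on `z + r u` is twice the gap 1/(n+1) - 1/(n+2), so the loss is exactly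
  -- affordable.
  have h4 : 1 / (((n + 1 : ℕ) : ℝ) + 1) =
      1 / ((n : ℝ) + 1) - 1 / 2 * (2 / (((n : ℝ) + 1) * (n + 2))) := by
    push_cast
    field_simp
    ring
  rw [h4]
  have h5 : t * ((z i + z j) * u m - (u i + u j) * z m) +
    ((-(round a * z m) : ℤ) : ℝ) + (-((a - round a) * (z m + r * u m))) =
      (t * (z i + z j) - (a - round a) * r) * u m := by
    push_cast
    rw [ha]
    ring
  rw [h5] at h2
  linarith

/-! ### Volume of a cube swept along a positive direction. -/

/-- The linear map whose matrix is the identity with column `i` replaced by `u`. -/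
noncomputable def shear {k : ℕ} (u : Fin k → ℝ) (i : Fin k) :
    (Fin k → ℝ) →ₗ[ℝ] (Fin k → ℝ) :=
  Matrix.toLin' ((1 : Matrix (Fin k) (Fin k) ℝ).updateCol i u)

lemma det_shear {k : ℕ} (u : Fin k → ℝ) (i : Fin k) : LinearMap.det (shear u i) = u i := by
  rw [shear, LinearMap.det_toLin', ← Matrix.cramer_apply, Matrix.cramer_one]
  rfl

lemma shear_apply {k : ℕ} (u : Fin k → ℝ) (i : Fin k) (y : Fin k → ℝ) :
    shear u i y = Function.update y i 0 + y i • u := by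
  ext m
  simp only [shear, Matrix.toLin'_apply, Matrix.mulVec, dotProduct, Pi.add_apply, Pi.smul_apply,
    smul_eq_mul]
  rw [← Finset.add_sum_erase _ _ (Finset.mem_univ i)]
  rw [Matrix.updateCol_self, add_comm, mul_comm]
  congr 1
  have : ∀ x ∈ Finset.univ.erase i, (1 : Matrix (Fin k) (Fin k) ℝ).updateCol i u m x * y x =
      if x = m then Function.update y i 0 x else 0 := by
    intro x hx
    have hx' := Finset.ne_of_mem_erase hx
    rw [Matrix.updateCol_ne hx', Matrix.one_apply, Function.update_of_ne hx']
    by_cases e : x = m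
    · simp [e]
    · simp [e, Ne.symm e]
  rw [Finset.sum_congr rfl this, Finset.sum_ite_eq']
  split_ifs with hm
  · rfl
  · have : m = i := by simpa using hm
    simp [this]

/-- The product of a unit interval in direction `i` and intervals of length `ε` in the other
directions. -/
def slab {k : ℕ} (ε : ℝ) (i : Fin k) : Set (Fin k → ℝ) :=
  Set.pi Set.univ fun m => if m = i then Set.Ico 0 1 else Set.Ioo 0 ε

lemma mem_slab {k : ℕ} {ε : ℝ} {i : Fin k} {y : Fin k → ℝ} :
    y ∈ slab ε i ↔ (0 ≤ y i ∧ y i < 1) ∧ ∀ m, m ≠ i → 0 < y m ∧ y m < ε := by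
  simp only [slab, Set.mem_pi, Set.mem_univ, true_implies]
  constructor
  · intro h
    refine ⟨by simpa using h i, fun m hm => by simpa [hm] using h m⟩
  · rintro ⟨h1, h2⟩ m
    by_cases hm : m = i
    · subst hm; simpa using h1
    · simpa [hm] using h2 m hm

lemma volume_slab {n : ℕ} {ε : ℝ} (hε : 0 < ε) (i : Fin (n + 1)) :
    volume (slab ε i) = ENNReal.ofReal (ε ^ n) := by
  rw [slab, volume_pi, Measure.pi_pi, ← Finset.mul_prod_erase _ _ (Finset.mem_univ i)]
  rw [Finset.prod_congr (g := fun _ => ENNReal.ofReal ε) rfl]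
  · simp [ENNReal.ofReal_pow hε.le]
  · intro m hm
    simp [Finset.ne_of_mem_erase hm]

lemma measurableSet_slab {k : ℕ} (ε : ℝ) (i : Fin k) : MeasurableSet (slab ε i) := by
  refine MeasurableSet.univ_pi fun m => ?_
  split_ifs
  · exact measurableSet_Ico
  · exact measurableSet_Ioo

lemma update_nonneg_of_mem_slab {k : ℕ} {ε : ℝ} {i : Fin k} {y : Fin k → ℝ} (hy : y ∈ slab ε i)
    (m : Fin k) : 0 ≤ Function.update y i 0 m := by
  by_cases hm : m = i
  · subst hm; simp
  · rw [Function.update_of_ne hm]; exact ((mem_slab.1 hy).2 m hm).1.le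

lemma update_lt_of_mem_slab {k : ℕ} {ε : ℝ} (hε : 0 < ε) {i : Fin k} {y : Fin k → ℝ}
    (hy : y ∈ slab ε i) (m : Fin k) : Function.update y i 0 m < ε := by
  by_cases hm : m = i
  · subst hm; simpa
  · rw [Function.update_of_ne hm]; exact ((mem_slab.1 hy).2 m hm).2

/-- The front faces of a box meet every line in a positive direction at most once. -/
lemma eq_zero_of_front_sub_front {k : ℕ} {u : Fin k → ℝ} (hu : ∀ i, 0 < u i) {ε : ℝ}
    {i i' : Fin k} {y y' : Fin k → ℝ} (hy : y ∈ slab ε i) (hy' : y' ∈ slab ε i') {c : ℝ}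
    (h : ∀ m, Function.update y i 0 m - Function.update y' i' 0 m = c * u m) : c = 0 := by
  have h1 := h i
  have h2 := h i'
  have h3 := update_nonneg_of_mem_slab hy i'
  have h4 := update_nonneg_of_mem_slab hy' i
  rw [Function.update_self] at h1 h2
  refine le_antisymm ?_ ?_
  · by_contra! hc
    have := mul_pos hc (hu i)
    linarith
  · by_contra! hc
    have := mul_neg_of_neg_of_pos hc (hu i')
    linarith

/-- The two face points lie on one line parallel to `u`, hence coincide. If `i ≠ i'`, their `i`-th
coordinates are 0 and positive, since the slab is open at 0 there. -/
lemma eq_of_shear_eq {k : ℕ} {u : Fin k → ℝ} (hu : ∀ i, 0 < u i) {ε : ℝ}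
    {i i' : Fin k} {y y' : Fin k → ℝ} (hy : y ∈ slab ε i) (hy' : y' ∈ slab ε i')
    (h : shear u i y = shear u i' y') : i = i' := by
  simp only [shear_apply] at h
  have h' : ∀ m, Function.update y i 0 m - Function.update y' i' 0 m =
      (y' i' - y i) * u m := fun m => by
    have := congrFun h m
    simp only [Pi.add_apply, Pi.smul_apply, smul_eq_mul] at this
    linarith
  have hc := eq_zero_of_front_sub_front hu hy hy' h'
  by_contra hne
  have h1 := h' i
  rw [hc, Function.update_self, Function.update_of_ne hne] at h1
  have := ((mem_slab.1 hy').2 i hne).1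
  linarith

/-- The box of side `ε` swept along `u` for a unit of time, without the box itself. -/
def sweep {k : ℕ} (u : Fin k → ℝ) (ε : ℝ) : Set (Fin k → ℝ) :=
  ⋃ i ∈ (Finset.univ : Finset (Fin k)), shear u i '' slab ε i

lemma measurableSet_shear_image {k : ℕ} {u : Fin k → ℝ} (hu : ∀ i, 0 < u i) (ε : ℝ) (i : Fin k) :
    MeasurableSet (shear u i '' slab ε i) := by
  have hdet : LinearMap.det (shear u i) ≠ 0 := by rw [det_shear]; exact (hu i).ne'
  let g := ((shear u i).equivOfDetNeZero hdet).toContinuousLinearEquiv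
  change MeasurableSet (g '' slab ε i)
  exact g.toHomeomorph.measurableEmbedding.measurableSet_image.2 (measurableSet_slab ε i)

lemma measurableSet_sweep {k : ℕ} {u : Fin k → ℝ} (hu : ∀ i, 0 < u i) (ε : ℝ) :
    MeasurableSet (sweep u ε) :=
  Finset.measurableSet_biUnion _ fun i _ => measurableSet_shear_image hu ε i

lemma volume_sweep {n : ℕ} {u : Fin (n + 1) → ℝ} (hu : ∀ i, 0 < u i) {ε : ℝ} (hε : 0 < ε) :
    volume (sweep u ε) = ENNReal.ofReal ((∑ i, u i) * ε ^ n) := by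
  rw [sweep, measure_biUnion_finset]
  · rw [Finset.sum_mul, ENNReal.ofReal_sum_of_nonneg (fun i _ => by have := hu i; positivity)]
    refine Finset.sum_congr rfl fun i _ => ?_
    rw [Measure.addHaar_image_linearMap, det_shear, volume_slab hε, abs_of_pos (hu i),
      ENNReal.ofReal_mul (hu i).le]
  · intro i _ i' _ hne
    rw [Function.onFun, Set.disjoint_left]
    rintro _ ⟨y, hy, rfl⟩ ⟨y', hy', h⟩
    exact hne (eq_of_shear_eq hu hy' hy h).symm
  · exact fun i _ => measurableSet_shear_image hu ε i

/-! ### Integer points near the line spanned by the speeds. -/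

/-- Blichfeldt's principle for the integer lattice. -/
lemma exists_int_sub_of_one_lt_volume {k : ℕ} {S : Set (Fin k → ℝ)} (hS : MeasurableSet S)
    (h : 1 < volume S) :
    ∃ z : Fin k → ℤ, z ≠ 0 ∧ ∃ x ∈ S, ∃ y ∈ S, ∀ i, (z i : ℝ) = x i - y i := by
  classical
  let b := Pi.basisFun ℝ (Fin k)
  have hF : volume (ZSpan.fundamentalDomain b) = 1 := by
    rw [ZSpan.fundamentalDomain_pi_basisFun, volume_pi, Measure.pi_pi]
    simp
  have : Countable (Submodule.span ℤ (Set.range b)).toAddSubgroup :=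
    inferInstanceAs (Countable (Submodule.span ℤ (Set.range b)))
  obtain ⟨p, q, hpq, hd⟩ := exists_pair_mem_lattice_not_disjoint_vadd
    (ZSpan.isAddFundamentalDomain' b volume) hS.nullMeasurableSet (hF.trans_lt h)
  rw [Set.not_disjoint_iff] at hd
  obtain ⟨_, ⟨x, hx, rfl⟩, ⟨y, hy, hxy⟩⟩ := hd
  have hint := (Module.Basis.mem_span_iff_repr_mem ℤ b _).1 (q - p).2
  choose z hz using hint
  have hz' : ∀ i, (z i : ℝ) = (q : Fin k → ℝ) i - (p : Fin k → ℝ) i := fun i => by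
    simpa [b] using hz i
  refine ⟨z, ?_, x, hx, y, hy, fun i => ?_⟩
  · rintro rfl
    apply hpq
    ext i
    have := hz' i
    simp only [Pi.zero_apply, Int.cast_zero] at this
    linarith
  · have : (q : Fin k → ℝ) i + y i = (p : Fin k → ℝ) i + x i := congrFun hxy i
    rw [hz']
    linarith

/-- Minkowski's theorem for the projection of a cube along a primitive positive vector `u`. -/
lemma exists_approx {n : ℕ} (u : Fin (n + 1) → ℤ) (hu : ∀ i, 0 < u i)
    (hgcd : Finset.univ.gcd u = 1) {ε : ℝ} (hε : 0 < ε) (hvol : 1 < (∑ i, (u i : ℝ)) * ε ^ n) :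
    ∃ (z : Fin (n + 1) → ℤ) (r : ℝ), (¬ ∀ i j, z i * u j = z j * u i) ∧
      ∀ i, |z i + r * u i| ≤ ε := by
  have hu' : ∀ i, (0 : ℝ) < u i := fun i => by exact_mod_cast hu i
  obtain ⟨z, hz0, x, hx, x', hx', hz⟩ := exists_int_sub_of_one_lt_volume
    (measurableSet_sweep hu' ε) (by rwa [volume_sweep hu' hε, ENNReal.one_lt_ofReal])
  simp only [sweep, Set.mem_iUnion, Finset.mem_univ, exists_true_left] at hx hx'
  obtain ⟨i, y, hy, rfl⟩ := hx
  obtain ⟨i', y', hy', rfl⟩ := hx'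
  simp only [shear_apply, Pi.add_apply, Pi.smul_apply, smul_eq_mul] at hz
  refine ⟨z, y' i' - y i, fun hpar => hz0 ?_, fun m => ?_⟩
  · have hc : ∀ m, (z m : ℝ) = z 0 / u 0 * u m := fun m => by
      have h0 := (hu' 0).ne'
      have : (z m : ℝ) * u 0 = z 0 * u m := by exact_mod_cast hpar m 0
      field_simp
      exact this
    -- If z is parallel to `u`, the face points coincide, so z = (y i - y' i') u with a factor of
    -- size below 1; primitivity of `u` then forces z = 0.
    have hzero := eq_zero_of_front_sub_front hu' hy hy' (c := z 0 / u 0 - (y i - y' i'))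
      (fun m => by have := hz m; rw [hc m] at this; linarith)
    ext m
    have hdvd : u m ∣ z m := by
      have : u m ∣ Finset.univ.gcd fun j => z m * u j :=
        Finset.dvd_gcd fun j _ => ⟨z j, by rw [hpar m j]; ring⟩
      rw [Finset.gcd_mul_left, hgcd, mul_one] at this
      exact (dvd_normalize_iff).1 this
    refine Int.eq_zero_of_abs_lt_dvd hdvd ?_
    have h1 := (mem_slab.1 hy).1
    have h2 := (mem_slab.1 hy').1
    have h3 : |(z m : ℝ)| < u m := by
      rw [hc m, show (z 0 : ℝ) / u 0 = y i - y' i' by linarith, abs_mul, abs_of_pos (hu' m)]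
      have : |y i - y' i'| < 1 := by rw [abs_lt]; constructor <;> linarith
      nlinarith [hu' m]
    exact_mod_cast h3
  · rw [hz m, abs_le]
    have h1 := update_nonneg_of_mem_slab hy m
    have h2 := update_nonneg_of_mem_slab hy' m
    have h3 := update_lt_of_mem_slab hε hy m
    have h4 := update_lt_of_mem_slab hε hy' m
    constructor <;> linarith

/-- If the conjecture holds for one runner less, then a primitive tuple of large sum has the
lonely runner property. -/
lemma hasLRProperty_of_lt_sum {n : ℕ} (h : LRC n) (u : Fin (n + 1) → ℤ) (hu : ∀ i, 0 < u i)
    (hgcd : Finset.univ.gcd u = 1)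
    (hsum : (((n + 2).choose 2 : ℕ) : ℝ) ^ n < ∑ i, (u i : ℝ)) :
    HasLRProperty (fun i => (u i : ℝ)) := by
  have hch : (((n + 2).choose 2 : ℕ) : ℝ) = ((n : ℝ) + 1) * (n + 2) / 2 := by
    rw [Nat.cast_choose_two]; push_cast; ring
  have hpos : (0 : ℝ) < ((n + 2).choose 2 : ℕ) := by rw [hch]; positivity
  obtain ⟨z, r, hz, hr⟩ := exists_approx u hu hgcd (inv_pos.2 hpos) (by
    rw [inv_pow, ← div_eq_mul_inv, one_lt_div (by positivity)]
    exact hsum)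
  refine hasLRProperty_of_approx h u z hu hz r fun i => (hr i).trans_eq ?_
  rw [hch, inv_div]

/-! ### Proper residues and divisibility of the speeds. -/

lemma half_le_distInt_half : 1 / 2 ≤ distInt (1 / 2) := by
  rw [le_distInt_iff]
  intro m
  rcases le_or_gt m 0 with h | h
  · have h' : (m : ℝ) ≤ 0 := by exact_mod_cast h
    exact le_trans (by linarith) (le_abs_self _)
  · have h' : (1 : ℝ) ≤ m := by exact_mod_cast h
    exact le_trans (by linarith) (neg_le_abs _)

/-- If all speeds but one share a factor prime to the remaining speed, the conjecture for one
runner less applies. -/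
lemma hasLRProperty_of_dvd {n : ℕ} (hn : 2 ≤ n) (h : LRC n) (u : Fin (n + 1) → ℤ)
    (hu : ∀ i, 0 < u i) (i : Fin (n + 1)) {d : ℤ} (hd : 1 < d) (hdvd : ∀ j, j ≠ i → d ∣ u j)
    (hcop : IsCoprime d (u i)) : HasLRProperty (fun i => (u i : ℝ)) := by
  obtain ⟨t, ht⟩ := h.exists_time_ne u i fun m _ => (hu m).ne'
  obtain ⟨a, b, hab⟩ := hcop
  have hd' : (2 : ℝ) ≤ d := by exact_mod_cast hd
  have hd0 : (d : ℝ) ≠ 0 := by positivity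
  have hn' : (2 : ℝ) ≤ n := by exact_mod_cast hn
  -- Shifting the time by N b / d moves the other products by integers and `t * u i` by N/d modulo
  -- 1. This `N` brings it within 1/(2d) ≤ 1/4 of 1/2, and 1/4 ≥ 1/(n+2) because `n ≥ 2`.
  set N := round ((d : ℝ) * (1 / 2 - t * u i)) with hN
  refine ⟨t + N * b / d, fun j => ?_⟩
  push_cast
  by_cases hj : j = i
  · subst hj
    have e : (t + N * b / d) * u j =
        1 / 2 + (N / d - (1 / 2 - t * u j)) + ((-(N * a) : ℤ) : ℝ) := by
      have hab' : (a : ℝ) * d + b * u j = 1 := by exact_mod_cast hab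
      push_cast
      field_simp
      linear_combination (2 * N : ℝ) * hab'
    have h1 : |(N : ℝ) / d - (1 / 2 - t * u j)| ≤ 1 / 4 := by
      have h2 := abs_sub_round ((d : ℝ) * (1 / 2 - t * u j))
      rw [← hN, abs_sub_comm] at h2
      have h3 : (N : ℝ) / d - (1 / 2 - t * u j) = (N - d * (1 / 2 - t * u j)) / d := by
        field_simp
      rw [h3, abs_div, abs_of_pos (by linarith : (0 : ℝ) < d), div_le_iff₀ (by linarith)]
      linarith
    have h4 := distInt_sub_le (1 / 2) (N / d - (1 / 2 - t * u j))
    have h5 := half_le_distInt_half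
    have h6 : 1 / ((n : ℝ) + 1 + 1) ≤ 1 / 4 :=
      one_div_le_one_div_of_le (by norm_num) (by linarith)
    rw [e]
    refine le_trans ?_ (distInt_le_add_int _ _)
    linarith
  · obtain ⟨c, hc⟩ := hdvd j hj
    have e : (t + N * b / d) * u j = t * u j + ((N * b * c : ℤ) : ℝ) := by
      rw [hc]
      push_cast
      field_simp
    rw [e]
    refine le_trans ?_ ((ht j hj).trans (distInt_le_add_int _ _))
    exact one_div_le_one_div_of_le (by linarith) (by linarith)

/-- A primitive tuple whose reduction modulo `l * p` is proper has the lonely runner property. -/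
lemma hasLRProperty_of_isProper {n : ℕ} (hn : 2 ≤ n) (h : LRC n) (u : Fin (n + 1) → ℤ)
    (hu : ∀ i, 0 < u i) (hgcd : Finset.univ.gcd u = 1) {p l : ℕ} (hp : 0 < p) (hl : 0 < l)
    (hprop : IsProper (n + 1) p l fun i => (u i : ZMod (l * p))) :
    HasLRProperty (fun i => (u i : ℝ)) := by
  have : NeZero (l * p) := ⟨(Nat.mul_pos hl hp).ne'⟩
  have hval : ∀ i, (((u i : ZMod (l * p)).val : ℕ) : ℤ) = u i % ((l * p : ℕ) : ℤ) :=
    fun i => ZMod.val_intCast (u i)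
  rcases hprop with ⟨i, hi⟩ | ⟨m, hm⟩
  · set d := Nat.gcd l ((Finset.univ.erase i).gcd fun j => (u j : ZMod (l * p)).val) with hd
    have hdvd : ∀ j, j ≠ i → (d : ℤ) ∣ u j := by
      intro j hj
      have h1 : (d : ℤ) ∣ ((l * p : ℕ) : ℤ) :=
        Int.natCast_dvd_natCast.2 ((Nat.gcd_dvd_left _ _).trans (dvd_mul_right l p))
      have h2 : d ∣ (u j : ZMod (l * p)).val :=
        (Nat.gcd_dvd_right _ _).trans (Finset.gcd_dvd (by simpa using hj))
      have h3 := Int.natCast_dvd_natCast.2 h2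
      rw [hval] at h3
      exact (EuclideanDomain.dvd_mod_iff h1).1 h3
    refine hasLRProperty_of_dvd hn h u hu i (d := d) (by exact_mod_cast hi) hdvd ?_
    rw [Int.isCoprime_iff_gcd_eq_one]
    have h4 : ((Int.gcd d (u i) : ℕ) : ℤ) ∣ Finset.univ.gcd u := by
      refine Finset.dvd_gcd fun j _ => ?_
      by_cases hj : j = i
      · subst hj; exact Int.gcd_dvd_right _ _
      · exact (Int.gcd_dvd_left _ _).trans (hdvd j hj)
    rw [hgcd] at h4
    exact Nat.dvd_one.1 (by exact_mod_cast h4)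
  · refine ⟨m / (l * p), fun i => (hm i).trans ?_⟩
    have h1 := Int.emod_add_mul_ediv (u i) ((l * p : ℕ) : ℤ)
    rw [← hval] at h1
    have h2 : ((u i : ZMod (l * p)).val : ℝ) + (l * p) * ((u i / ((l * p : ℕ) : ℤ) : ℤ) : ℝ)
        = u i := by exact_mod_cast congrArg (Int.cast : ℤ → ℝ) h1
    have hl' : (l : ℝ) ≠ 0 := by positivity
    have hp' : (p : ℝ) ≠ 0 := by positivity
    have e : (m : ℝ) / (l * p) * u i = m / (l * p) * ((u i : ZMod (l * p)).val : ℝ) +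
        ((m * (u i / ((l * p : ℕ) : ℤ)) : ℤ) : ℝ) := by
      rw [← h2, Int.cast_mul]
      field_simp
    rw [e]
    exact distInt_le_add_int _ _

/-- If `J (n + 1) p` is empty, then `p` divides one of the speeds of every primitive
counterexample. -/
lemma exists_dvd_of_J_eq_empty {n : ℕ} (hn : 2 ≤ n) (h : LRC n) (u : Fin (n + 1) → ℤ)
    (hu : ∀ i, 0 < u i) (hgcd : Finset.univ.gcd u = 1)
    (hLR : ¬ HasLRProperty (fun i => (u i : ℝ))) {p : ℕ} (hp : 0 < p) (hJ : J (n + 1) p = ∅) :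
    ∃ i, (p : ℤ) ∣ u i := by
  by_contra! hcon
  have hne : ∀ i, (u i : ZMod p) ≠ 0 := fun i hi =>
    hcon i ((ZMod.intCast_zmod_eq_zero_iff_dvd _ _).1 hi)
  have hev : EventuallyProper (n + 1) p fun i => (u i : ZMod p) := by
    by_contra hnot
    have : (fun i => (u i : ZMod p)) ∈ J (n + 1) p :=
      ⟨fun i ⟨y, hy⟩ => hne i (by simpa using hy), hnot⟩
    simp [hJ] at this
  obtain ⟨l, hl, hnot⟩ := hev
  refine hnot ⟨fun i => (u i : ZMod (l * p)), ⟨fun i ⟨y, hy⟩ => hne i ?_, fun hprop =>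
    hLR (hasLRProperty_of_isProper hn h u hu hgcd hp hl hprop)⟩, ?_⟩
  · have := congrArg (ZMod.castHom (Dvd.intro_left l rfl : p ∣ l * p) (ZMod p)) hy
    simpa using this
  · ext i
    simp [proj]

/-! ### Comparison of the product with the sum. -/

/-- Disposes of the equality case of AM-GM. -/
lemma hasLRProperty_of_const {k : ℕ} (hk : 1 ≤ k) {u : Fin k → ℝ} {c : ℝ} (hc : c ≠ 0)
    (h : ∀ i, u i = c) : HasLRProperty u := by
  refine ⟨1 / (2 * c), fun i => ?_⟩
  have e : 1 / (2 * c) * u i = 1 / 2 := by rw [h i]; field_simp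
  have hk' : (1 : ℝ) ≤ k := by exact_mod_cast hk
  rw [e]
  exact (one_div_le_one_div_of_le (by norm_num) (by linarith)).trans half_le_distInt_half

/-- The strict inequality of arithmetic and geometric means, without roots. -/
lemma prod_lt_avg_pow {k : ℕ} {u : Fin k → ℝ} (hu : ∀ i, 0 < u i) (hne : ∃ i j, u i ≠ u j) :
    ∏ i, u i < ((∑ i, u i) / k) ^ k := by
  obtain ⟨a, b, hab⟩ := hne
  have hk : 0 < k := a.pos
  have hk' : (0 : ℝ) < k := by exact_mod_cast hk
  have hw : ∑ _i : Fin k, (1 / (k : ℝ)) = 1 := by simp [hk'.ne']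
  have hle := Real.geom_mean_le_arith_mean_weighted Finset.univ (fun _ => 1 / (k : ℝ)) u
    (fun _ _ => by positivity) hw (fun i _ => (hu i).le)
  have hne' := mt (Real.geom_mean_eq_arith_mean_weighted_iff_of_pos Finset.univ
    (fun _ => 1 / (k : ℝ)) u (fun _ _ => by positivity) hw (fun i _ => (hu i).le)).1
    (fun hall => hab (hall a (Finset.mem_univ a) b (Finset.mem_univ b)))
  have hlt := lt_of_le_of_ne hle hne'
  rw [Real.finsetProd_rpow _ _ (fun i _ => (hu i).le), ← Finset.mul_sum] at hlt
  have hprod : 0 ≤ ∏ i, u i := Finset.prod_nonneg fun i _ => (hu i).le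
  have := pow_lt_pow_left₀ hlt (Real.rpow_nonneg hprod _) hk.ne'
  rw [one_div, Real.rpow_inv_natCast_pow hprod hk.ne'] at this
  rwa [div_eq_inv_mul]

/-- The proposition for primitive tuples. -/
lemma hasLRProperty_of_primitive {n : ℕ} (hn : 2 ≤ n) {P : Finset ℕ} (hP : ∀ p ∈ P, p.Prime)
    (hJ : ∀ p ∈ P, J (n + 1) p = ∅) (h : LRC n) (hB : B (n + 1) ≤ ∏ p ∈ P, (p : ℝ))
    (u : Fin (n + 1) → ℤ) (hu : ∀ i, 0 < u i) (hgcd : Finset.univ.gcd u = 1) :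
    HasLRProperty (fun i => (u i : ℝ)) := by
  by_contra hLR
  have hu' : ∀ i, (0 : ℝ) < u i := fun i => by exact_mod_cast hu i
  have hdvd : (∏ p ∈ P, (p : ℤ)) ∣ ∏ i, u i := by
    refine Finset.prod_dvd_of_coprime (fun p hp q hq hpq => ?_) fun p hp => ?_
    · exact Nat.isCoprime_iff_coprime.2 ((Nat.coprime_primes (hP p hp) (hP q hq)).2 hpq)
    · obtain ⟨i, hi⟩ := exists_dvd_of_J_eq_empty hn h u hu hgcd hLR (hP p hp).pos (hJ p hp)
      exact hi.trans (Finset.dvd_prod_of_mem u (Finset.mem_univ i))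
  have hle : (∏ p ∈ P, (p : ℝ)) ≤ ∏ i, (u i : ℝ) := by
    have := Int.cast_le (R := ℝ).2 (Int.le_of_dvd (Finset.prod_pos fun i _ => hu i) hdvd)
    simpa only [Int.cast_prod, Int.cast_natCast] using this
  have hsum : ∑ i, (u i : ℝ) ≤ (((n + 2).choose 2 : ℕ) : ℝ) ^ n :=
    not_lt.1 fun hlt => hLR (hasLRProperty_of_lt_sum h u hu hgcd hlt)
  -- Strictness in AM-GM is essential, as `hB` allows equality.
  have hne : ∃ i j, (u i : ℝ) ≠ u j := by
    by_contra! hcon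
    exact hLR (hasLRProperty_of_const (by lia) (hu' 0).ne' fun i => hcon i 0)
  have hlt := prod_lt_avg_pow hu' hne
  have hpow : ((∑ i, (u i : ℝ)) / (n + 1 : ℕ)) ^ (n + 1) ≤ B (n + 1) := by
    have hs : 0 ≤ ∑ i, (u i : ℝ) := Finset.sum_nonneg fun i _ => (hu' i).le
    rw [B]
    exact pow_le_pow_left₀ (by positivity) (div_le_div_of_nonneg_right hsum (by positivity)) _
  linarith

end LonelyRunner

theorem mainTheorem5 (k : ℕ) (hk : 3 ≤ k) (P : Finset ℕ) (hP : ∀ p ∈ P, p.Prime)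
    (hJ : ∀ p ∈ P, LonelyRunner.J k p = ∅)
    (hLRC : LonelyRunner.LRC (k - 1))
    (hB : LonelyRunner.B k ≤ ∏ p ∈ P, (p : ℝ)) :
    LonelyRunner.LRC k := by
  obtain ⟨n, rfl⟩ : ∃ n, k = n + 1 := ⟨k - 1, by lia⟩
  rw [Nat.add_sub_cancel] at hLRC
  intro u hu
  obtain ⟨v, hv, hgcd⟩ := Finset.extract_gcd u (Finset.univ_nonempty (α := Fin (n + 1)))
  have hg : 0 < Finset.univ.gcd u := by
    refine lt_of_le_of_ne ((Int.nonneg_iff_normalize_eq_self _).1 Finset.normalize_gcd) fun h0 => ?_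
    exact (hu 0).ne' (Finset.gcd_eq_zero_iff.1 h0.symm 0 (Finset.mem_univ 0))
  have hv0 : ∀ i, 0 < v i := fun i =>
    pos_of_mul_pos_right ((hv i (Finset.mem_univ i)) ▸ hu i) hg.le
  obtain ⟨t, ht⟩ := LonelyRunner.hasLRProperty_of_primitive (by lia) hP hJ hLRC hB v hv0 hgcd
  -- Scaling all speeds by the gcd only rescales time.
  refine ⟨t / (Finset.univ.gcd u : ℤ), fun i => (ht i).trans_eq ?_⟩
  have hg' : ((Finset.univ.gcd u : ℤ) : ℝ) ≠ 0 := by exact_mod_cast hg.ne'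
  have e : (u i : ℝ) = (Finset.univ.gcd u : ℤ) * v i := by
    exact_mod_cast hv i (Finset.mem_univ i)
  congr 1
  change t * (v i : ℝ) = t / (Finset.univ.gcd u : ℤ) * (u i : ℝ)
  rw [e]
  field_simp
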